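/- Let $D$ be an absolutely continuous cumulative distribution function supported on $[0,1]$ with density $d\ge 0$, let $\ell:\mathbb R\times\mathbb R\to\mathbb R$ be a loss function, and let $X$ be a real random variable with distribution function $F_X$. A generalized extremile of $X$ is a point $$e\in\operatorname*{arg\,min}_{c\in\mathbb R}\ \mathbb E\big[d(F_X(X))\,(\ell(X,c)-\ell(X,0))\big],$$ where these expectations are required to be finite. Write $\ell'(x,c)$ for the derivative of $\ell$ with respect to $c$ (the right-hand derivative at points of non-differentiability) and put $$\lambda_F(c)=\int_{\mathbb R} d(F_X(x))\,\ell'(x,c)\,\mathrm dF_X(x).$$ Assume: (A1) $X$ has a density with respect to Lebesgue measure; $\lambda_F(c)$ is finite (i.e. $d(F_X(X))\ell'(X,c)$ is integrable) for every $c$, and $\lambda_F$ has a unique root; $c\mapsto\ell(x,c)$ is convex for every $x$; $x\mapsto \ell'(x,c)$ is measurable for every $c$. (A3) $\ell'(x,c)=h_1(x,c)-h_2(x,c)$ for all $x,c$, where $x\mapsto h_j(x,c)$ is non-decreasing and left continuous for every $c$, $j=1,2$. (A4) There is $r>0$ such that $\mathbb E|h_j(X,c)|^r<\infty$ for every $c$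 and $j=1,2$. (A5) With this $r$, there are $M,\gamma>0$ such that $|d(t)|\le M[t(1-t)]^{-1+1/r+\gamma}$ for all $t\in(0,1)$. (A7) $d$ is continuous on $(0,1)$ except possibly at finitely many points. Let $X_1,X_2,\dots$ be i.i.d. copies of $X$, let $F_n(x)=(n+1)^{-1}\sum_{i=1}^n 1_{\{X_i\le x\}}$ and $$\lambda^*_{F_n}(c)=\frac1n\sum_{i=1}^n d(F_n(X_i))\,\ell'(X_i,c).$$ Let $T_n^*$ be an M-estimator, i.e. almost surely, for all large $n$, $T_n^*$ is a root of $\lambda^*_{F_n}$ (any root, for instance the smallest one) or, if there is no root, a minimizer of $|\lambda^*_{F_n}|$; if $|\lambda^*_{F_n}|$ has no minimizer, $T_n^*$ is a point at which the infimum of $|\lambda^*_{F_n}|$ is approached, that is, the limit of a sequence $(c_k)$ with $|\lambda^*_{F_n}(c_k)|\to\inf_c|\lambda^*_{F_n}(c)|$. Then $X$ has exactly one generalized extremile $e$, and $T_n^*\to e$ almost surely as $n\to\infty$. -/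

import Mathlib

open MeasureTheory ProbabilityTheory Filter Set Topology

noncomputable section

/-- `D` is an absolutely continuous cumulative distribution function supported on `[0,1]`,
with (Borel, nonnegative) density `d`. -/
structure IsDistortion (D d : ℝ → ℝ) : Prop where
  measurable_density : Measurable d
  nonneg_density : ∀ t, 0 ≤ d t
  integrable_density : Integrable d volume
  integral_density : ∫ t, d t = 1
  eq_integral : ∀ u, D u = ∫ t in Iic u, d t
  map_zero : D 0 = 0
  map_one : D 1 = 1

/-- The derivative `ℓ'(x, c)` of the loss `ℓ(x, c)` in `c`, taken from the right. It is the usual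
derivative wherever that exists, and it always exists if `c ↦ ℓ(x, c)` is convex. -/
def lossDeriv (ℓ : ℝ → ℝ → ℝ) (x c : ℝ) : ℝ :=
  derivWithin (fun s => ℓ x s) (Ioi c) c

/-- `e` is a generalized extremile of `X ∼ μ`: the expectations
`E[d(F_X(X)) (ℓ(X, c) - ℓ(X, 0))]` are finite and `e` minimizes them over `c ∈ ℝ`. -/
structure IsGeneralizedExtremile (μ : Measure ℝ) (d : ℝ → ℝ) (ℓ : ℝ → ℝ → ℝ) (e : ℝ) :
    Prop where
  integrable : ∀ c, Integrable (fun x => d (cdf μ x) * (ℓ x c - ℓ x 0)) μ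
  minimizes : ∀ c, ∫ x, d (cdf μ x) * (ℓ x e - ℓ x 0) ∂μ ≤
    ∫ x, d (cdf μ x) * (ℓ x c - ℓ x 0) ∂μ

/-- `λ_F(c) = ∫ d(F_X(x)) ℓ'(x, c) dF_X(x)`, where `μ` is the law of `X`. -/
def lambdaF (μ : Measure ℝ) (d : ℝ → ℝ) (ℓ : ℝ → ℝ → ℝ) (c : ℝ) : ℝ :=
  ∫ x, d (cdf μ x) * lossDeriv ℓ x c ∂μ

/-- The rescaled empirical distribution function
`F_n(x) = (n + 1)⁻¹ ∑ 1{X_i ≤ x}` of the sample `X 0, …, X (n - 1)`. -/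
def empiricalCdf (X : ℕ → ℝ) (n : ℕ) (x : ℝ) : ℝ :=
  ((n : ℝ) + 1)⁻¹ * ∑ i ∈ Finset.range n, (Iic x).indicator (fun _ => (1 : ℝ)) (X i)

/-- `λ*_{F_n}(c) = n⁻¹ ∑ d(F_n(X_i)) ℓ'(X_i, c)` for the sample `X 0, …, X (n - 1)`. -/
def lambdaStar (d : ℝ → ℝ) (ℓ : ℝ → ℝ → ℝ) (X : ℕ → ℝ) (n : ℕ) (c : ℝ) : ℝ :=
  (n : ℝ)⁻¹ * ∑ i ∈ Finset.range n, d (empiricalCdf X n (X i)) * lossDeriv ℓ (X i) c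

/-- `c` is an admissible value of the M-estimator with estimating function `g`: a root of `g` (any
root, so in particular the smallest one), or, if `g` has no root, a minimizer of `|g|`. If `|g|`
does not attain its infimum at all (a jump of `g` across zero may have this effect), then `c` is a
point at which the infimum is approached. -/
def IsMEstimate (g : ℝ → ℝ) (c : ℝ) : Prop :=
  g c = 0 ∨
  ((∀ s, g s ≠ 0) ∧ ∀ s, |g c| ≤ |g s|) ∨
  ((∀ s, ∃ u, |g u| < |g s|) ∧ ∀ ε > 0, ∀ s, ∃ u, |u - c| < ε ∧ |g u| ≤ |g s|)

end

/-! The right derivative of a convex loss is a subgradient. Integrating against the nonnegative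
weight makes `lambdaF` a nondecreasing subgradient of the objective, so its unique root `e` is the
unique extremile. Since `lambdaStar` is nondecreasing too, its M-estimates are trapped near `e` once
it converges pointwise at the countably many points `e + q`, `q` rational
(`tendsto_of_isMEstimate`).

That convergence is a strong law for L-statistics (`ae_tendsto_average_mul_empiricalCdf`). A cutoff
removes neighbourhoods of `0`, `1` and the discontinuities of `d`. On what is left,
Glivenko-Cantelli and uniform continuity allow `F_n` to be replaced by `F`, and the ordinary strong
law applies. For the part removed, put `t = F_n(X_i)` and `y = t(1 - t)`: Markov's inequality for
the monotone `h_j` gives `|ℓ'| ≤ K y^(-1/r)`, so the growth bound on `d` makes each term at most `MK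
y^(-1+γ)`. Averages of `y^(-a)` with `a < 1` are bounded uniformly because ranks are distinct, so
terms with small `y` contribute little, and the others are controlled by the fraction of the sample
removed. -/

/-! ### Subgradients of a convex loss -/

theorem ConvexOn.sub_mul_rightDeriv_le {f : ℝ → ℝ} (hf : ConvexOn ℝ univ f) (e c : ℝ) :
    (c - e) * derivWithin f (Ioi e) e ≤ f c - f e := by
  rcases lt_trichotomy c e with h | rfl | h
  · have h1 : slope f c e ≤ derivWithin f (Iio e) e :=
      hf.slope_le_leftDeriv_of_mem_interior (mem_univ c) (by simp) h
    have h2 := hf.leftDeriv_le_rightDeriv_of_mem_interior (x := e) (by simp)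
    have h3 := h1.trans h2
    rw [slope_def_field, div_le_iff₀ (by linarith)] at h3
    linarith
  · simp
  · have h1 := hf.rightDeriv_le_slope_of_mem_interior (x := e) (by simp) (mem_univ c) h
    rw [slope_def_field, le_div_iff₀ (by linarith)] at h1
    linarith

theorem lossDeriv_monotone {ℓ : ℝ → ℝ → ℝ} (hconv : ∀ x, ConvexOn ℝ univ (fun c => ℓ x c))
    (x : ℝ) : Monotone (lossDeriv ℓ x) := by
  have := (hconv x).monotoneOn_rightDeriv
  rw [interior_univ] at this
  exact monotoneOn_univ.mp this

theorem sub_mul_lossDeriv_le {ℓ : ℝ → ℝ → ℝ} (hconv : ∀ x, ConvexOn ℝ univ (fun c => ℓ x c))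
    (x e c : ℝ) : (c - e) * lossDeriv ℓ x e ≤ ℓ x c - ℓ x e :=
  (hconv x).sub_mul_rightDeriv_le e c

/-- The increments of a convex loss are limits of Riemann sums of its right derivative. -/
theorem tendsto_riemannSum_lossDeriv {ℓ : ℝ → ℝ → ℝ}
    (hconv : ∀ x, ConvexOn ℝ univ (fun c => ℓ x c)) (x c : ℝ) :
    Tendsto (fun n : ℕ => ∑ k ∈ Finset.range n, (c / n) * lossDeriv ℓ x (k * (c / n))) atTop
      (𝓝 (ℓ x c - ℓ x 0)) := by
  -- Subgradient inequalities at the two ends of each cell bound the increment from both sides; the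
  -- gap between the bounds telescopes. The sign of `c` plays no role.
  have key : ∀ n : ℕ, 0 < n →
      ∑ k ∈ Finset.range n, (c / n) * lossDeriv ℓ x (k * (c / n)) ≤ ℓ x c - ℓ x 0 ∧
      ℓ x c - ℓ x 0 - (c / n) * (lossDeriv ℓ x c - lossDeriv ℓ x 0) ≤
        ∑ k ∈ Finset.range n, (c / n) * lossDeriv ℓ x (k * (c / n)) := by
    intro n hn
    have hn' : (n : ℝ) ≠ 0 := by positivity
    have hend : (n : ℝ) * (c / n) = c := by field_simp
    have htel : ∑ k ∈ Finset.range n, (ℓ x ((k + 1 : ℕ) * (c / n)) - ℓ x (k * (c / n))) =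
        ℓ x c - ℓ x 0 := by
      rw [Finset.sum_range_sub (fun k : ℕ => ℓ x (k * (c / n)))]
      simp [hend]
    have htel2 : ∑ k ∈ Finset.range n, (lossDeriv ℓ x ((k + 1 : ℕ) * (c / n)) -
        lossDeriv ℓ x (k * (c / n))) = lossDeriv ℓ x c - lossDeriv ℓ x 0 := by
      rw [Finset.sum_range_sub (fun k : ℕ => lossDeriv ℓ x (k * (c / n)))]
      simp [hend]
    constructor
    · rw [← htel]
      refine Finset.sum_le_sum fun k _ => ?_
      have := sub_mul_lossDeriv_le hconv x (k * (c / n)) ((k + 1 : ℕ) * (c / n))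
      push_cast at this ⊢
      linarith
    · rw [← htel, ← htel2, Finset.mul_sum, ← Finset.sum_sub_distrib]
      refine Finset.sum_le_sum fun k _ => ?_
      have := sub_mul_lossDeriv_le hconv x ((k + 1 : ℕ) * (c / n)) (k * (c / n))
      push_cast at this ⊢
      linarith
  have hlim : Tendsto (fun n : ℕ => ℓ x c - ℓ x 0 - (c / n) * (lossDeriv ℓ x c - lossDeriv ℓ x 0))
      atTop (𝓝 (ℓ x c - ℓ x 0)) := by
    have h0 : Tendsto (fun n : ℕ => c / (n : ℝ)) atTop (𝓝 0) :=
      tendsto_const_div_atTop_nhds_zero_nat c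
    simpa using tendsto_const_nhds.sub (h0.mul_const (lossDeriv ℓ x c - lossDeriv ℓ x 0))
  refine tendsto_of_tendsto_of_tendsto_of_le_of_le' hlim tendsto_const_nhds ?_ ?_
  · filter_upwards [eventually_gt_atTop 0] with n hn using (key n hn).2
  · filter_upwards [eventually_gt_atTop 0] with n hn using (key n hn).1

/-- Measurability is assumed only for the derivative; Riemann sums transfer it to the increments of
the loss. -/
theorem measurable_loss_sub {ℓ : ℝ → ℝ → ℝ} (hconv : ∀ x, ConvexOn ℝ univ (fun c => ℓ x c))
    (hmeas : ∀ c, Measurable (fun x => lossDeriv ℓ x c)) (c : ℝ) :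
    Measurable (fun x => ℓ x c - ℓ x 0) := by
  refine measurable_of_tendsto_metrizable (f := fun (n : ℕ) x =>
    ∑ k ∈ Finset.range n, (c / n) * lossDeriv ℓ x (k * (c / n))) (fun n => ?_) ?_
  · exact Finset.measurable_fun_sum _ fun k _ => (hmeas _).const_mul _
  · exact tendsto_pi_nhds.2 fun x => tendsto_riemannSum_lossDeriv hconv x c

/-! ### The extremile as the root of `lambdaF` -/

section Extremile

variable {μ : Measure ℝ} {d : ℝ → ℝ} {ℓ : ℝ → ℝ → ℝ}

theorem lambdaF_monotone (hd : ∀ t, 0 ≤ d t)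
    (hfin : ∀ c, Integrable (fun x => d (cdf μ x) * lossDeriv ℓ x c) μ)
    (hconv : ∀ x, ConvexOn ℝ univ (fun c => ℓ x c)) : Monotone (lambdaF μ d ℓ) := fun a b hab =>
  integral_mono (hfin a) (hfin b) fun x =>
    mul_le_mul_of_nonneg_left (lossDeriv_monotone hconv x hab) (hd _)

/-- The subgradients at `0` and `c` trap the increment between `c * ℓ'(x, 0)` and `c * ℓ'(x, c)`. -/
theorem integrable_weighted_loss (hdm : Measurable d) (hd : ∀ t, 0 ≤ d t)
    (hfin : ∀ c, Integrable (fun x => d (cdf μ x) * lossDeriv ℓ x c) μ)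
    (hconv : ∀ x, ConvexOn ℝ univ (fun c => ℓ x c))
    (hmeas : ∀ c, Measurable (fun x => lossDeriv ℓ x c)) (c : ℝ) :
    Integrable (fun x => d (cdf μ x) * (ℓ x c - ℓ x 0)) μ := by
  refine (((hfin 0).const_mul c).abs.add ((hfin c).const_mul c).abs).mono' ?_ ?_
  · exact ((hdm.comp (monotone_cdf μ).measurable).mul
      (measurable_loss_sub hconv hmeas c)).aestronglyMeasurable
  · refine ae_of_all _ fun x => ?_
    have h1 := mul_le_mul_of_nonneg_left (sub_mul_lossDeriv_le hconv x 0 c) (hd (cdf μ x))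
    have h2 := mul_le_mul_of_nonneg_left (sub_mul_lossDeriv_le hconv x c 0) (hd (cdf μ x))
    rw [Real.norm_eq_abs]
    simp only [Pi.add_apply]
    have a1 := neg_abs_le (c * (d (cdf μ x) * lossDeriv ℓ x 0))
    have a2 := le_abs_self (c * (d (cdf μ x) * lossDeriv ℓ x c))
    have a3 := abs_nonneg (c * (d (cdf μ x) * lossDeriv ℓ x 0))
    have a4 := abs_nonneg (c * (d (cdf μ x) * lossDeriv ℓ x c))
    rw [abs_le]
    constructor <;> nlinarith

theorem sub_mul_lambdaF_le (hdm : Measurable d) (hd : ∀ t, 0 ≤ d t)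
    (hfin : ∀ c, Integrable (fun x => d (cdf μ x) * lossDeriv ℓ x c) μ)
    (hconv : ∀ x, ConvexOn ℝ univ (fun c => ℓ x c))
    (hmeas : ∀ c, Measurable (fun x => lossDeriv ℓ x c)) (e c : ℝ) :
    (c - e) * lambdaF μ d ℓ e ≤ ∫ x, d (cdf μ x) * (ℓ x c - ℓ x 0) ∂μ -
      ∫ x, d (cdf μ x) * (ℓ x e - ℓ x 0) ∂μ := by
  have hi := integrable_weighted_loss hdm hd hfin hconv hmeas
  rw [lambdaF, ← integral_const_mul, ← integral_sub (hi c) (hi e)]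
  refine integral_mono ((hfin e).const_mul _) ((hi c).sub (hi e)) fun x => ?_
  have h1 := mul_le_mul_of_nonneg_left (sub_mul_lossDeriv_le hconv x e c) (hd (cdf μ x))
  simp only
  linarith

theorem isGeneralizedExtremile_iff (hdm : Measurable d) (hd : ∀ t, 0 ≤ d t)
    (hfin : ∀ c, Integrable (fun x => d (cdf μ x) * lossDeriv ℓ x c) μ)
    (hconv : ∀ x, ConvexOn ℝ univ (fun c => ℓ x c))
    (hmeas : ∀ c, Measurable (fun x => lossDeriv ℓ x c)) {e : ℝ} (he : lambdaF μ d ℓ e = 0)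
    (huniq : ∀ t, lambdaF μ d ℓ t = 0 → t = e) (c : ℝ) :
    IsGeneralizedExtremile μ d ℓ c ↔ c = e := by
  have hi := integrable_weighted_loss hdm hd hfin hconv hmeas
  have hsub := sub_mul_lambdaF_le hdm hd hfin hconv hmeas
  have hm := lambdaF_monotone hd hfin hconv
  constructor
  · intro hc
    by_contra hne
    -- At the midpoint `lambdaF` is nonzero, with the sign of `c - e`, so the objective is strictly
    -- larger at `c` than at the midpoint.
    have h1 := hsub ((c + e) / 2) c
    have h2 := hc.minimizes ((c + e) / 2)
    have h3 : lambdaF μ d ℓ ((c + e) / 2) ≠ 0 := fun h => hne (by linarith [huniq _ h])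
    rcases lt_or_gt_of_ne hne with h | h
    · have h4 : lambdaF μ d ℓ ((c + e) / 2) < 0 :=
        lt_of_le_of_ne (he ▸ hm (by linarith)) h3
      nlinarith
    · have h4 : 0 < lambdaF μ d ℓ ((c + e) / 2) :=
        lt_of_le_of_ne (he ▸ hm (by linarith)) h3.symm
      nlinarith
  · rintro rfl
    refine ⟨hi, fun s => ?_⟩
    have := hsub c s
    rw [he, mul_zero] at this
    linarith

end Extremile

/-! ### Continuous distribution functions and Pólya's theorem -/

section Cdf

variable {μ : Measure ℝ} [IsProbabilityMeasure μ]

theorem measure_Ioc_eq_cdf_sub (a b : ℝ) : μ (Ioc a b) = ENNReal.ofReal (cdf μ b - cdf μ a) := by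
  conv_lhs => rw [← measure_cdf μ]
  exact StieltjesFunction.measure_Ioc _ _ _

theorem continuous_cdf [NullSingletonClass μ] : Continuous (cdf μ) := by
  rw [continuous_iff_continuousAt]
  intro x
  refine continuousAt_iff_continuous_left'_right'.2 ⟨?_, ?_⟩
  · rw [(monotone_cdf μ).continuousWithinAt_Iio_iff_leftLim_eq]
    have h1 : μ {x} = 0 := measure_singleton x
    rw [← measure_cdf μ, StieltjesFunction.measure_singleton, ENNReal.ofReal_eq_zero] at h1
    exact le_antisymm ((monotone_cdf μ).leftLim_le le_rfl) (by linarith)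
  · exact ((cdf μ).right_continuous x).mono Ioi_subset_Ici_self

/-- The cdf takes the same value at the two extreme points of a compact piece of a level set, so the
interval between them is null. Hence finitely many discontinuities of `d` are not seen by `d ∘ F`.
-/
theorem ae_cdf_ne [NullSingletonClass μ] (s : ℝ) : ∀ᵐ x ∂μ, cdf μ x ≠ s := by
  rw [ae_iff]
  simp only [not_not]
  refine measure_null_of_locally_null _ fun x hx => ?_
  have hcl : IsClosed {y | cdf μ y = s} := isClosed_eq continuous_cdf continuous_const
  have hK : IsCompact ({y | cdf μ y = s} ∩ Icc (x - 1) (x + 1)) :=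
    isCompact_Icc.inter_left hcl
  have hne : ({y | cdf μ y = s} ∩ Icc (x - 1) (x + 1)).Nonempty :=
    ⟨x, hx, by constructor <;> linarith⟩
  refine ⟨_, inter_mem_nhdsWithin _ (Icc_mem_nhds (a := x - 1) (b := x + 1)
    (by linarith) (by linarith)), ?_⟩
  obtain ⟨a, ha, hamin⟩ := hK.exists_isLeast hne
  obtain ⟨b, hb, hbmax⟩ := hK.exists_isGreatest hne
  refine measure_mono_null (t := Icc a b) (fun y hy => ⟨hamin hy, hbmax hy⟩) ?_
  rw [← Ioc_ae_eq_Icc.measure_eq, measure_Ioc_eq_cdf_sub, ha.1, hb.1]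
  simp

end Cdf

/-- Pólya's theorem: pointwise convergence of monotone functions with values in `[0, 1]` to a
continuous distribution function is uniform. -/
theorem tendstoUniformly_of_monotone {F : ℝ → ℝ} {G : ℕ → ℝ → ℝ} (hF : Monotone F)
    (hFc : Continuous F) (hF0 : Tendsto F atBot (𝓝 0)) (hF1 : Tendsto F atTop (𝓝 1))
    (hG : ∀ n, Monotone (G n)) (hG0 : ∀ n x, 0 ≤ G n x) (hG1 : ∀ n x, G n x ≤ 1)
    (hlim : ∀ q : ℚ, Tendsto (fun n => G n q) atTop (𝓝 (F q))) :
    TendstoUniformly G F atTop := by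
  have hF0' : ∀ x, 0 ≤ F x := fun x => hF.le_of_tendsto hF0 x
  have hF1' : ∀ x, F x ≤ 1 := fun x => hF.ge_of_tendsto hF1 x
  rw [Metric.tendstoUniformly_iff]
  intro ε hε
  -- Left of `p` and right of `q`, monotonicity and the bounds `0`, `1` suffice; `[p, q]` is handled
  -- by compactness.
  obtain ⟨p, hp⟩ : ∃ p : ℚ, F p < ε / 2 := by
    obtain ⟨x, hx⟩ := (hF0.eventually (gt_mem_nhds (half_pos hε))).exists
    obtain ⟨p, hp⟩ := exists_rat_lt x
    exact ⟨p, (hF hp.le).trans_lt hx⟩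
  obtain ⟨q, hq⟩ : ∃ q : ℚ, 1 - ε / 2 < F q := by
    obtain ⟨x, hx⟩ := (hF1.eventually (lt_mem_nhds (show 1 - ε / 2 < 1 by linarith))).exists
    obtain ⟨q, hq⟩ := exists_rat_gt x
    exact ⟨q, hx.trans_le (hF hq.le)⟩
  have hnear : ∀ a : ℚ, ∀ᶠ n in atTop, |G n a - F a| < ε / 2 := fun a => by
    simpa [Real.dist_eq] using Metric.tendsto_nhds.1 (hlim a) (ε / 2) (half_pos hε)
  have hloc : TendstoLocallyUniformlyOn G F atTop (Icc (p : ℝ) q) := by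
    rw [Metric.tendstoLocallyUniformlyOn_iff]
    intro δ hδ x _
    have hx : ∀ᶠ y in 𝓝 x, |F y - F x| < δ / 4 := by
      simpa [Real.dist_eq] using Metric.tendsto_nhds.1 (hFc.tendsto x) (δ / 4) (by linarith)
    obtain ⟨u, hu, hball⟩ := Metric.eventually_nhds_iff.1 hx
    -- Between rationals `a < x < b` both functions are squeezed by their values at `a` and `b`.
    obtain ⟨a, ha1, ha2⟩ := exists_rat_btwn (show x - u < x by linarith)
    obtain ⟨b, hb1, hb2⟩ := exists_rat_btwn (show x < x + u by linarith)
    refine ⟨Ioo (a : ℝ) b, mem_nhdsWithin_of_mem_nhds (Ioo_mem_nhds ha2 hb1), ?_⟩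
    have hFa := abs_lt.1 (@hball a (by rw [Real.dist_eq, abs_lt]; constructor <;> linarith))
    have hFb := abs_lt.1 (@hball b (by rw [Real.dist_eq, abs_lt]; constructor <;> linarith))
    have hna := Metric.tendsto_nhds.1 (hlim a) (δ / 4) (by linarith)
    have hnb := Metric.tendsto_nhds.1 (hlim b) (δ / 4) (by linarith)
    filter_upwards [hna, hnb] with n hna hnb y hy
    rw [Real.dist_eq, abs_lt] at *
    have h1 := hG n hy.1.le
    have h2 := hG n hy.2.le
    have h3 := hF hy.1.le
    have h4 := hF hy.2.le
    constructor <;> linarith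
  rw [tendstoLocallyUniformlyOn_iff_tendstoUniformlyOn_of_compact isCompact_Icc,
    Metric.tendstoUniformlyOn_iff] at hloc
  filter_upwards [hloc ε hε, hnear p, hnear q] with n hn hnp hnq x
  rw [abs_lt] at hnp hnq
  rcases lt_or_ge x p with hx | hx
  · have h1 := hG n hx.le
    have h2 := hF hx.le
    have h3 := hF0' x
    have h4 := hG0 n x
    rw [Real.dist_eq, abs_lt]
    constructor <;> linarith
  rcases lt_or_ge (q : ℝ) x with hx' | hx'
  · have h1 := hG n hx'.le
    have h2 := hF hx'.le
    have h3 := hF1' x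
    have h4 := hG1 n x
    rw [Real.dist_eq, abs_lt]
    constructor <;> linarith
  exact hn x ⟨hx, hx'⟩

/-! ### Strong law and absence of ties -/

section Sample

variable {Ω : Type*} [MeasurableSpace Ω] {P : Measure Ω}
  {μ : Measure ℝ} {X : ℕ → Ω → ℝ}

theorem ae_tendsto_average (hindep : iIndepFun X P) (hlaw : ∀ i, HasLaw (X i) μ P) {f : ℝ → ℝ}
    (hf : Measurable f) (hint : Integrable f μ) :
    ∀ᵐ ω ∂P, Tendsto (fun n : ℕ => (n : ℝ)⁻¹ * ∑ i ∈ Finset.range n, f (X i ω)) atTop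
      (𝓝 (∫ x, f x ∂μ)) := by
  have h := strong_law_ae (μ := P) (fun i ω => f (X i ω)) ?_ ?_ ?_
  · have he : ∫ ω, f (X 0 ω) ∂P = ∫ x, f x ∂μ :=
      (hlaw 0).integral_comp hint.aestronglyMeasurable
    rw [he] at h
    simpa only [smul_eq_mul] using h
  · have := (hlaw 0).map_eq ▸ hint
    exact this.comp_aemeasurable (hlaw 0).aemeasurable
  · intro i j hij
    exact (hindep.indepFun hij).comp hf hf
  · intro i
    exact ((hlaw i).identDistrib (hlaw 0)).comp hf

/-- By independence a pair of observations has law `μ.prod μ`, for which the diagonal is null as `μ`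
has no atoms. -/
theorem ae_injective_sample [IsProbabilityMeasure P] [IsProbabilityMeasure μ] [NullSingletonClass μ]
    (hindep : iIndepFun X P) (hlaw : ∀ i, HasLaw (X i) μ P) :
    ∀ᵐ ω ∂P, Function.Injective fun i => X i ω := by
  have h : ∀ i j, i ≠ j → ∀ᵐ ω ∂P, X i ω ≠ X j ω := by
    intro i j hij
    have hmap := (indepFun_iff_map_prod_eq_prod_map_map (hlaw i).aemeasurable
      (hlaw j).aemeasurable).1 (hindep.indepFun hij)
    rw [(hlaw i).map_eq, (hlaw j).map_eq] at hmap
    have hms : MeasurableSet {p : ℝ × ℝ | p.1 ≠ p.2} :=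
      (measurableSet_eq_fun measurable_fst measurable_snd).compl
    have hprod : ∀ᵐ p ∂(μ.prod μ), p.1 ≠ p.2 := by
      rw [Measure.ae_prod_iff_ae_ae hms]
      refine ae_of_all _ fun x => ?_
      rw [ae_iff]
      simp
    rw [← hmap] at hprod
    exact ae_of_ae_map ((hlaw i).aemeasurable.prodMk (hlaw j).aemeasurable) hprod
  have h' : ∀ᵐ ω ∂P, ∀ i j, i ≠ j → X i ω ≠ X j ω := by
    rw [ae_all_iff]; intro i
    rw [ae_all_iff]; intro j
    exact eventually_imp_distrib_left.2 (h i j)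
  filter_upwards [h'] with ω hω i j hij
  by_contra hne
  exact hω i j hne hij

end Sample

/-! ### Bounds along a fixed sample -/

section EmpiricalCdf

theorem empiricalCdf_eq_card (x : ℕ → ℝ) (n : ℕ) (z : ℝ) :
    empiricalCdf x n z = ((n : ℝ) + 1)⁻¹ * ({j ∈ Finset.range n | x j ≤ z} : Finset ℕ).card := by
  simp [empiricalCdf, indicator_apply, Finset.sum_boole]

theorem empiricalCdf_monotone (x : ℕ → ℝ) (n : ℕ) : Monotone (empiricalCdf x n) := by
  intro a b hab
  rw [empiricalCdf_eq_card, empiricalCdf_eq_card]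
  gcongr

theorem empiricalCdf_nonneg (x : ℕ → ℝ) (n : ℕ) (z : ℝ) : 0 ≤ empiricalCdf x n z := by
  rw [empiricalCdf_eq_card]; positivity

/-- The factor `(n + 1)⁻¹` in place of `n⁻¹` keeps the value off `1`, where the growth bound on `d`
says nothing. -/
theorem empiricalCdf_lt_one (x : ℕ → ℝ) (n : ℕ) (z : ℝ) : empiricalCdf x n z < 1 := by
  have h : ((({j ∈ Finset.range n | x j ≤ z} : Finset ℕ).card : ℕ) : ℝ) ≤ n := by
    have := Finset.card_filter_le (Finset.range n) (fun j => x j ≤ z)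
    rw [Finset.card_range] at this
    exact_mod_cast this
  rw [empiricalCdf_eq_card, inv_mul_lt_iff₀ (by positivity)]
  linarith

theorem empiricalCdf_sample_pos (x : ℕ → ℝ) {n i : ℕ} (hi : i ∈ Finset.range n) :
    0 < empiricalCdf x n (x i) := by
  have : 0 < ({j ∈ Finset.range n | x j ≤ x i} : Finset ℕ).card :=
    Finset.card_pos.2 ⟨i, by simp [Finset.mem_range.1 hi]⟩
  rw [empiricalCdf_eq_card]; positivity

theorem empiricalCdf_sample_mul_pos (x : ℕ → ℝ) {n i : ℕ} (hi : i ∈ Finset.range n) :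
    0 < empiricalCdf x n (x i) * (1 - empiricalCdf x n (x i)) :=
  mul_pos (empiricalCdf_sample_pos x hi) (sub_pos.2 (empiricalCdf_lt_one x n _))

/-- Markov's inequality for a monotone function under the empirical distribution. -/
theorem abs_rpow_mul_empiricalCdf_le {h : ℝ → ℝ} (hh : Monotone h) {r A : ℝ} (hr : 0 < r)
    (x : ℕ → ℝ) {n i : ℕ} (hi : i ∈ Finset.range n)
    (hA : (n : ℝ)⁻¹ * ∑ j ∈ Finset.range n, |h (x j)| ^ r ≤ A) :
    |h (x i)| ^ r * (empiricalCdf x n (x i) * (1 - empiricalCdf x n (x i))) ≤ A := by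
  have hn : (0 : ℝ) < n := by exact_mod_cast (Nat.zero_le i).trans_lt (Finset.mem_range.1 hi)
  set t := empiricalCdf x n (x i) with ht
  have ht0 : 0 < t := empiricalCdf_sample_pos x hi
  have ht1 : t < 1 := empiricalCdf_lt_one x n _
  have hp : 0 ≤ |h (x i)| ^ r := by positivity
  have hA0 : 0 ≤ A := le_trans (by positivity) hA
  rw [inv_mul_le_iff₀ hn] at hA
  have markov : ∀ s : Finset ℕ, s ⊆ Finset.range n → (∀ j ∈ s, |h (x i)| ≤ |h (x j)|) →
      (s.card : ℝ) * |h (x i)| ^ r ≤ n * A := by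
    intro s hs hle
    refine le_trans ?_ hA
    calc (s.card : ℝ) * |h (x i)| ^ r = ∑ _j ∈ s, |h (x i)| ^ r := by simp
      _ ≤ ∑ j ∈ s, |h (x j)| ^ r := Finset.sum_le_sum fun j hj =>
          Real.rpow_le_rpow (abs_nonneg _) (hle j hj) hr.le
      _ ≤ ∑ j ∈ Finset.range n, |h (x j)| ^ r :=
          Finset.sum_le_sum_of_subset_of_nonneg hs fun _ _ _ => by positivity
  have hcard : ((({j ∈ Finset.range n | x j ≤ x i} : Finset ℕ).card : ℕ) : ℝ) = (n + 1) * t := by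
    rw [ht, empiricalCdf_eq_card]; field_simp
  -- If `h (x i) ≤ 0`, then `|h|` is at least as large at all sample points to the left; if `h (x i)
  -- ≥ 0`, at all those to the right.
  have hbound : t * |h (x i)| ^ r ≤ A ∨ (1 - t) * |h (x i)| ^ r ≤ A := by
    rcases le_total (h (x i)) 0 with h0 | h0
    · left
      have h1 := markov {j ∈ Finset.range n | x j ≤ x i} (Finset.filter_subset _ _) fun j hj => by
        have := hh (Finset.mem_filter.1 hj).2
        rw [abs_of_nonpos h0, abs_of_nonpos (this.trans h0)]
        linarith
      rw [hcard] at h1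
      by_contra! hlt
      nlinarith
    · right
      -- Adding `i` itself raises the count to exactly `(n + 1) * (1 - t)`.
      have h1 := markov (insert i {j ∈ Finset.range n | ¬ x j ≤ x i})
        (Finset.insert_subset hi (Finset.filter_subset _ _)) fun j hj => by
          rcases Finset.mem_insert.1 hj with rfl | hj
          · exact le_rfl
          · have := hh (not_le.1 (Finset.mem_filter.1 hj).2).le
            rw [abs_of_nonneg h0, abs_of_nonneg (h0.trans this)]
            exact this
      have h2 := Finset.card_filter_add_card_filter_not (s := Finset.range n)
        (fun j => x j ≤ x i)
      rw [Finset.card_insert_of_notMem (by simp)] at h1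
      have h3 : (({j ∈ Finset.range n | ¬ x j ≤ x i} : Finset ℕ).card : ℝ) = n - (n + 1) * t := by
        rw [Finset.card_range] at h2
        rw [← hcard, eq_sub_iff_add_eq']
        exact_mod_cast h2
      push_cast at h1
      rw [h3] at h1
      by_contra! hlt
      nlinarith
  rcases hbound with hb | hb <;> nlinarith [mul_nonneg hp ht0.le, mul_nonneg hp (sub_pos.2 ht1).le]

theorem abs_le_of_average_le {h : ℝ → ℝ} (hh : Monotone h) {r A : ℝ} (hr : 0 < r)
    (x : ℕ → ℝ) {n i : ℕ} (hi : i ∈ Finset.range n)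
    (hA : (n : ℝ)⁻¹ * ∑ j ∈ Finset.range n, |h (x j)| ^ r ≤ A) :
    |h (x i)| ≤ A ^ (1 / r) *
      (empiricalCdf x n (x i) * (1 - empiricalCdf x n (x i))) ^ (-(1 / r)) := by
  have hy := empiricalCdf_sample_mul_pos x hi
  have h1 := abs_rpow_mul_empiricalCdf_le hh hr x hi hA
  have hA0 : 0 ≤ A := le_trans (by positivity) hA
  rw [← le_div_iff₀ hy] at h1
  have h2 := Real.rpow_le_rpow (by positivity) h1 (show 0 ≤ 1 / r by positivity)
  rw [← Real.rpow_mul (abs_nonneg _), mul_one_div_cancel hr.ne', Real.rpow_one,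
    Real.div_rpow hA0 hy.le] at h2
  rwa [Real.rpow_neg hy.le, ← div_eq_mul_inv]

/-- Induction replaces comparison with an integral; the step is Bernoulli's inequality for `(1 -
1/(n+1))^(1-a)`. -/
theorem sum_rpow_neg_le {a : ℝ} (ha0 : 0 ≤ a) (ha1 : a < 1) (n : ℕ) :
    ∑ k ∈ Finset.range n, ((k : ℝ) + 1) ^ (-a) ≤ (n : ℝ) ^ (1 - a) / (1 - a) := by
  have hb : 0 < 1 - a := by linarith
  induction n with
  | zero => simp [Real.zero_rpow hb.ne']
  | succ n ih =>
    rw [Finset.sum_range_succ]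
    refine (add_le_add_left ih _).trans ?_
    have hx : (0 : ℝ) < n + 1 := by positivity
    have hle : ((n : ℝ) + 1)⁻¹ ≤ 1 := inv_le_one_of_one_le₀ (by linarith [n.cast_nonneg (α := ℝ)])
    have h1 := rpow_one_add_le_one_add_mul_self (s := -((n : ℝ) + 1)⁻¹) (p := 1 - a)
      (by linarith) hb.le (by linarith)
    have h2 : (1 + -((n : ℝ) + 1)⁻¹) = n / (n + 1) := by field_simp; ring
    rw [h2, Real.div_rpow (by positivity) hx.le, div_le_iff₀ (by positivity)] at h1
    have h3 : ((n : ℝ) + 1) ^ (-a) = ((n : ℝ) + 1) ^ (1 - a) * ((n : ℝ) + 1)⁻¹ := by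
      rw [← Real.rpow_neg_one, ← Real.rpow_add hx]; congr 1; ring
    push_cast
    rw [h3, le_div_iff₀ hb, add_mul, div_mul_cancel₀ _ hb.ne']
    linarith

/-- The ranks of distinct points are distinct. -/
theorem injOn_rank {x : ℕ → ℝ} (hx : Function.Injective x) (n : ℕ) :
    InjOn (fun i => ({j ∈ Finset.range n | x j ≤ x i} : Finset ℕ).card) (Finset.range n) := by
  have key : ∀ i ∈ Finset.range n, ∀ k ∈ Finset.range n, x i < x k →
      ({j ∈ Finset.range n | x j ≤ x i} : Finset ℕ).card <
      ({j ∈ Finset.range n | x j ≤ x k} : Finset ℕ).card := by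
    intro i hi k hk hlt
    refine Finset.card_lt_card (Finset.ssubset_iff_subset_ne.2 ⟨fun j hj => ?_, fun he => ?_⟩)
    · simp only [Finset.mem_filter] at hj ⊢
      exact ⟨hj.1, hj.2.trans hlt.le⟩
    · have : k ∈ ({j ∈ Finset.range n | x j ≤ x i} : Finset ℕ) := by
        rw [he]; simpa using hk
      exact absurd (Finset.mem_filter.1 this).2 (not_le.2 hlt)
  intro i hi k hk he
  by_contra hne
  rcases lt_or_gt_of_ne (hx.ne hne) with h | h
  · exact (key i hi k hk h).ne he
  · exact (key k hk i hi h).ne he.symm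

/-- Sums over the ranks of a sample of distinct points are at most sums over `1, …, n`. -/
theorem sum_empiricalCdf_le {x : ℕ → ℝ} (hx : Function.Injective x) (n : ℕ) {g : ℝ → ℝ}
    (hg : ∀ t ∈ Ioo (0 : ℝ) 1, 0 ≤ g t) :
    ∑ i ∈ Finset.range n, g (empiricalCdf x n (x i)) ≤
      ∑ k ∈ Finset.range n, g (((n : ℝ) + 1)⁻¹ * (k + 1)) := by
  set R : ℕ → ℕ := fun i => ({j ∈ Finset.range n | x j ≤ x i} : Finset ℕ).card with hR
  have hpos : ∀ i ∈ Finset.range n, 0 < R i := fun i hi =>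
    Finset.card_pos.2 ⟨i, by simp [Finset.mem_range.1 hi]⟩
  have hle : ∀ i, R i ≤ n := fun i => by
    simpa using Finset.card_filter_le (Finset.range n) (fun j => x j ≤ x i)
  -- Ranks start at `1`, so the truncated subtraction loses nothing.
  have hinj : InjOn (fun i => R i - 1) (Finset.range n) := by
    intro i hi k hk he
    have h1 := hpos i hi
    have h2 := hpos k hk
    exact injOn_rank hx n hi hk (by simp only at he; change R i = R k; omega)
  calc ∑ i ∈ Finset.range n, g (empiricalCdf x n (x i))
      = ∑ i ∈ Finset.range n, g (((n : ℝ) + 1)⁻¹ * ((R i - 1 : ℕ) + 1)) := by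
        refine Finset.sum_congr rfl fun i hi => ?_
        rw [empiricalCdf_eq_card, Nat.cast_sub (hpos i hi)]
        simp [hR]
    _ = ∑ k ∈ (Finset.range n).image (fun i => R i - 1), g (((n : ℝ) + 1)⁻¹ * (k + 1)) := by
        rw [Finset.sum_image hinj]
    _ ≤ _ := by
        refine Finset.sum_le_sum_of_subset_of_nonneg (fun k hk => ?_) fun k hk _ => hg _ ⟨?_, ?_⟩
        · obtain ⟨i, hi, rfl⟩ := Finset.mem_image.1 hk
          have h1 := hpos i hi
          have h2 := hle i
          exact Finset.mem_range.2 (by omega)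
        · positivity
        · rw [inv_mul_lt_iff₀ (by positivity)]
          have : (k : ℝ) < n := by exact_mod_cast Finset.mem_range.1 hk
          linarith

/-- The larger of `t` and `1 - t` is at least `1/2`, which costs the factor `2 ^ a`. -/
theorem rpow_neg_mul_one_sub_le {a t : ℝ} (ha : 0 ≤ a) (ht0 : 0 < t) (ht1 : t < 1) :
    (t * (1 - t)) ^ (-a) ≤ 2 ^ a * (t ^ (-a) + (1 - t) ^ (-a)) := by
  have hs : 0 < 1 - t := sub_pos.2 ht1
  have aux : ∀ u v : ℝ, 0 < u → 0 < v → 1 / 2 ≤ v → (u * v) ^ (-a) ≤ 2 ^ a * u ^ (-a) := by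
    intro u v hu hv hv2
    rw [Real.mul_rpow hu.le hv.le, mul_comm]
    gcongr
    calc v ^ (-a) ≤ (1 / 2 : ℝ) ^ (-a) :=
          Real.rpow_le_rpow_of_nonpos (by norm_num) hv2 (by linarith)
      _ = 2 ^ a := by
          rw [one_div, Real.inv_rpow (by norm_num), Real.rpow_neg (by norm_num), inv_inv]
  rw [mul_add]
  rcases le_total t (1 / 2) with h | h
  · exact (aux t (1 - t) ht0 hs (by linarith)).trans (le_add_of_nonneg_right (by positivity))
  · rw [mul_comm t]
    exact (aux (1 - t) t hs ht0 h).trans (le_add_of_nonneg_left (by positivity))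

/-- A Riemann sum bound for an integrable singularity. One `2 ^ a` comes from separating the two
endpoints, the other from `n + 1 ≤ 2 * n`, and the `2` from reflection. The bound depends on neither
`n` nor the sample. -/
theorem average_rpow_empiricalCdf_le {a : ℝ} (ha0 : 0 ≤ a) (ha1 : a < 1) {x : ℕ → ℝ}
    (hx : Function.Injective x) (n : ℕ) :
    (n : ℝ)⁻¹ * ∑ i ∈ Finset.range n,
      (empiricalCdf x n (x i) * (1 - empiricalCdf x n (x i))) ^ (-a) ≤
      2 ^ a * (2 ^ a * (2 / (1 - a))) := by
  have hb : 0 < 1 - a := by linarith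
  rcases Nat.eq_zero_or_pos n with rfl | hn
  · simp; positivity
  have hn' : (0 : ℝ) < n := by exact_mod_cast hn
  have hn1 : (1 : ℝ) ≤ n := by exact_mod_cast hn
  rw [inv_mul_le_iff₀ hn']
  refine (sum_empiricalCdf_le hx n (g := fun t => (t * (1 - t)) ^ (-a)) fun t ht =>
    Real.rpow_nonneg (mul_nonneg ht.1.le (sub_nonneg.2 ht.2.le)) _).trans ?_
  have hscale : ∑ k ∈ Finset.range n, (((n : ℝ) + 1)⁻¹ * (k + 1)) ^ (-a) ≤
      2 ^ a * n / (1 - a) := by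
    have h1 : ∀ k ∈ Finset.range n, (((n : ℝ) + 1)⁻¹ * (k + 1)) ^ (-a) =
        ((n : ℝ) + 1) ^ a * ((k : ℝ) + 1) ^ (-a) := fun k _ => by
      rw [Real.mul_rpow (by positivity) (by positivity), Real.inv_rpow (by positivity),
        ← Real.rpow_neg (by positivity), neg_neg]
    rw [Finset.sum_congr rfl h1, ← Finset.mul_sum]
    calc ((n : ℝ) + 1) ^ a * ∑ k ∈ Finset.range n, ((k : ℝ) + 1) ^ (-a)
        ≤ (2 * n) ^ a * ((n : ℝ) ^ (1 - a) / (1 - a)) := by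
          gcongr
          · linarith
          · exact sum_rpow_neg_le ha0 ha1 n
      _ = 2 ^ a * n / (1 - a) := by
          rw [Real.mul_rpow (by norm_num) hn'.le, mul_assoc, ← mul_div_assoc,
            ← Real.rpow_add hn', ← mul_div_assoc]
          norm_num
  have hrefl : ∑ k ∈ Finset.range n, (1 - ((n : ℝ) + 1)⁻¹ * (k + 1)) ^ (-a) =
      ∑ k ∈ Finset.range n, (((n : ℝ) + 1)⁻¹ * (k + 1)) ^ (-a) := by
    rw [← Finset.sum_range_reflect]
    refine Finset.sum_congr rfl fun k hk => ?_
    have : k < n := Finset.mem_range.1 hk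
    congr 1
    rw [show n - 1 - k = n - (k + 1) by omega, Nat.cast_sub (by omega)]
    push_cast
    field_simp
    ring
  calc ∑ k ∈ Finset.range n, (((n : ℝ) + 1)⁻¹ * (k + 1) * (1 - ((n : ℝ) + 1)⁻¹ * (k + 1))) ^ (-a)
      ≤ ∑ k ∈ Finset.range n, 2 ^ a * ((((n : ℝ) + 1)⁻¹ * (k + 1)) ^ (-a) +
          (1 - ((n : ℝ) + 1)⁻¹ * (k + 1)) ^ (-a)) := by
        refine Finset.sum_le_sum fun k hk => rpow_neg_mul_one_sub_le ha0 (by positivity) ?_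
        rw [inv_mul_lt_iff₀ (by positivity)]
        have : (k : ℝ) < n := by exact_mod_cast Finset.mem_range.1 hk
        linarith
    _ ≤ 2 ^ a * (2 ^ a * n / (1 - a) + 2 ^ a * n / (1 - a)) := by
        rw [← Finset.mul_sum, Finset.sum_add_distrib, hrefl]
        gcongr
    _ = n * (2 ^ a * (2 ^ a * (2 / (1 - a)))) := by ring

end EmpiricalCdf

/-! ### Cutoffs and the deterministic L-statistic limit -/

noncomputable section

/-- A continuous cutoff function that vanishes near `Z` and tends to `1` off `Z` as `m → ∞`. -/
def distCutoff (Z : Set ℝ) (m : ℕ) (t : ℝ) : ℝ :=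
  max 0 (min 1 (m * Metric.infDist t Z - 1))

theorem continuous_distCutoff (Z : Set ℝ) (m : ℕ) : Continuous (distCutoff Z m) :=
  continuous_const.max (continuous_const.min
    ((continuous_const.mul (Metric.continuous_infDist_pt Z)).sub continuous_const))

theorem distCutoff_nonneg (Z : Set ℝ) (m : ℕ) (t : ℝ) : 0 ≤ distCutoff Z m t := le_max_left _ _

theorem distCutoff_le_one (Z : Set ℝ) (m : ℕ) (t : ℝ) : distCutoff Z m t ≤ 1 :=
  max_le zero_le_one (min_le_left _ _)

theorem distCutoff_eq_zero {Z : Set ℝ} {m : ℕ} {t : ℝ} (h : m * Metric.infDist t Z ≤ 1) :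
    distCutoff Z m t = 0 :=
  max_eq_left ((min_le_right _ _).trans (by linarith))

theorem tendsto_distCutoff {Z : Set ℝ} (hZ : IsClosed Z) (hne : Z.Nonempty) {t : ℝ} (ht : t ∉ Z) :
    Tendsto (fun m => distCutoff Z m t) atTop (𝓝 1) := by
  have hpos : 0 < Metric.infDist t Z := (hZ.notMem_iff_infDist_pos hne).1 ht
  obtain ⟨N, hN⟩ := exists_nat_gt (2 / Metric.infDist t Z)
  refine tendsto_const_nhds.congr' ?_
  filter_upwards [eventually_ge_atTop N] with m hm
  have h1 : (N : ℝ) ≤ m := by exact_mod_cast hm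
  have h2 : 2 < m * Metric.infDist t Z := (div_lt_iff₀ hpos).1 (hN.trans_le h1)
  rw [distCutoff, min_eq_left (by linarith), max_eq_right zero_le_one]

/-- Near a point of `Z` the cutoff vanishes identically, so the behaviour of `d` there is
irrelevant. -/
theorem continuous_mul_distCutoff {d : ℝ → ℝ} {Z : Set ℝ} (hd : ∀ t ∉ Z, ContinuousAt d t)
    (m : ℕ) : Continuous fun t => d t * distCutoff Z m t := by
  rw [continuous_iff_continuousAt]
  intro t
  by_cases ht : t ∈ Z
  · have h0 : Tendsto (fun s => m * Metric.infDist s Z) (𝓝 t) (𝓝 0) := by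
      have : Continuous fun s => m * Metric.infDist s Z :=
        continuous_const.mul (Metric.continuous_infDist_pt Z)
      simpa [Metric.infDist_zero_of_mem ht] using this.tendsto t
    have h1 : (fun s => d s * distCutoff Z m s) =ᶠ[𝓝 t] fun _ => 0 := by
      filter_upwards [h0.eventually (gt_mem_nhds one_pos)] with s hs
      rw [distCutoff_eq_zero hs.le, mul_zero]
    exact continuousAt_const.congr h1.symm
  · exact (hd t ht).mul (continuous_distCutoff Z m).continuousAt

theorem distCutoff_eq_zero_of_notMem {Z : Set ℝ} (h0 : Iic 0 ⊆ Z) (h1 : Ici 1 ⊆ Z) {m : ℕ}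
    (hm : 0 < m) {t : ℝ} (ht : t ∉ Ioo (m : ℝ)⁻¹ (1 - (m : ℝ)⁻¹)) : distCutoff Z m t = 0 := by
  have hm' : (0 : ℝ) < m := by exact_mod_cast hm
  refine distCutoff_eq_zero ?_
  rw [← le_div_iff₀' hm', one_div]
  rw [mem_Ioo, not_and_or, not_lt, not_lt] at ht
  rcases ht with ht | ht
  · rcases le_total t 0 with h | h
    · rw [Metric.infDist_zero_of_mem (h0 h)]; positivity
    · refine (Metric.infDist_le_dist_of_mem (h0 (mem_Iic.2 le_rfl))).trans ?_
      rwa [Real.dist_eq, sub_zero, abs_of_nonneg h]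
  · rcases le_total 1 t with h | h
    · rw [Metric.infDist_zero_of_mem (h1 h)]; positivity
    · refine (Metric.infDist_le_dist_of_mem (h1 (mem_Ici.2 le_rfl))).trans ?_
      rw [Real.dist_eq, abs_of_nonpos (by linarith)]
      linarith

theorem uniformContinuous_of_eq_zero_off {g : ℝ → ℝ} (hg : Continuous g) {a b : ℝ}
    (h0 : ∀ t ∉ Ioo a b, g t = 0) : UniformContinuous g :=
  hg.uniformContinuous_of_tendsto_cocompact (x := 0) <| by
    have : HasCompactSupport g :=
      HasCompactSupport.intro (isCompact_Icc (a := a) (b := b)) fun t ht =>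
        h0 t fun h => ht (Ioo_subset_Icc_self h)
    exact this.is_zero_at_infty

theorem average_le_of_le {f : ℕ → ℝ} {n : ℕ} {η : ℝ} (hη : 0 ≤ η)
    (hf : ∀ i ∈ Finset.range n, f i ≤ η) : (n : ℝ)⁻¹ * ∑ i ∈ Finset.range n, f i ≤ η := by
  rcases Nat.eq_zero_or_pos n with rfl | hn
  · simpa
  rw [inv_mul_le_iff₀ (by exact_mod_cast hn)]
  simpa using Finset.sum_le_sum hf

/-- Where `F_n(x_i)` lies in `[δ/2, 1 - δ/2]`, `L` is bounded and uniform continuity applies;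
elsewhere `F_n` and `F` both miss the support interval once they are `δ/2`-close. -/
theorem tendsto_average_empiricalCdf_sub {g : ℝ → ℝ} (hg : UniformContinuous g) {δ : ℝ}
    (hδ : 0 < δ) (h0 : ∀ t ∉ Ioo δ (1 - δ), g t = 0) {x : ℕ → ℝ} {F : ℝ → ℝ}
    (hF : TendstoUniformly (empiricalCdf x) F atTop) {L : ℝ → ℝ} {K s : ℝ} (hs : 0 ≤ s)
    (hK : 0 ≤ K) (hL : ∀ n, ∀ i ∈ Finset.range n, |L (x i)| ≤
      K * (empiricalCdf x n (x i) * (1 - empiricalCdf x n (x i))) ^ (-s)) :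
    Tendsto (fun n : ℕ => (n : ℝ)⁻¹ * ∑ i ∈ Finset.range n,
      (g (empiricalCdf x n (x i)) - g (F (x i))) * L (x i)) atTop (𝓝 0) := by
  rw [Metric.tendsto_nhds]
  intro η hη
  set K' := K * (δ / 2 * (δ / 2)) ^ (-s) with hK'
  have hK'0 : 0 ≤ K' := by positivity
  obtain ⟨ρ, hρ, hgρ⟩ := Metric.uniformContinuous_iff.1 hg (η / 2 / (K' + 1)) (by positivity)
  filter_upwards [Metric.tendstoUniformly_iff.1 hF (min ρ (δ / 2)) (by positivity)] with n hn
  rw [Real.dist_eq, sub_zero, abs_mul, abs_of_nonneg (by positivity : (0 : ℝ) ≤ (n : ℝ)⁻¹)]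
  refine lt_of_le_of_lt ?_ (half_lt_self hη)
  refine (mul_le_mul_of_nonneg_left (Finset.abs_sum_le_sum_abs _ _) (by positivity)).trans
    (average_le_of_le (by positivity) fun i hi => ?_)
  set t := empiricalCdf x n (x i) with ht
  have hd := hn (x i)
  rw [← ht, lt_min_iff] at hd
  by_cases hmem : t ∈ Icc (δ / 2) (1 - δ / 2)
  · have h1 : |g t - g (F (x i))| ≤ η / 2 / (K' + 1) := by
      have := hgρ hd.1
      rw [dist_comm, Real.dist_eq] at this
      exact this.le
    have h2 : |L (x i)| ≤ K' := (hL n i hi).trans <| mul_le_mul_of_nonneg_left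
      (Real.rpow_le_rpow_of_nonpos (by positivity)
        (mul_le_mul hmem.1 (by linarith [hmem.2]) (by positivity) (by linarith [hmem.1]))
        (by linarith)) hK
    rw [abs_mul]
    calc |g t - g (F (x i))| * |L (x i)| ≤ η / 2 / (K' + 1) * (K' + 1) :=
          mul_le_mul h1 (by linarith) (abs_nonneg _) (by positivity)
      _ = η / 2 := by field_simp
  · have h1 : g t = 0 := h0 t fun h => hmem ⟨by linarith [h.1], by linarith [h.2]⟩
    have h2 : g (F (x i)) = 0 := by
      refine h0 _ fun h => hmem ?_
      have := abs_lt.1 (Real.dist_eq _ _ ▸ hd.2)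
      exact ⟨by linarith [h.1], by linarith [h.2]⟩
    rw [h1, h2, sub_zero, zero_mul, abs_zero]
    positivity

/-- Split at `y = ε`: half of `γ` yields the small factor, the other half keeps the remaining
exponent above `-1`. -/
theorem rpow_le_inv_add {γ ε y : ℝ} (hγ : 0 < γ) (hγ1 : γ ≤ 1) (hε : 0 < ε) (hε1 : ε ≤ 1)
    (hy : 0 < y) : y ^ (-1 + γ) ≤ ε⁻¹ + ε ^ (γ / 2) * y ^ (-(1 - γ / 2)) := by
  rcases le_total ε y with h | h
  · refine le_trans ?_ (le_add_of_nonneg_right (by positivity))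
    calc y ^ (-1 + γ) ≤ ε ^ (-1 + γ) := Real.rpow_le_rpow_of_nonpos hε h (by linarith)
      _ ≤ ε ^ (-1 : ℝ) := Real.rpow_le_rpow_of_exponent_ge hε hε1 (by linarith)
      _ = ε⁻¹ := Real.rpow_neg_one ε
  · refine le_trans ?_ (le_add_of_nonneg_left (by positivity))
    calc y ^ (-1 + γ) = y ^ (γ / 2) * y ^ (-(1 - γ / 2)) := by
          rw [← Real.rpow_add hy]; congr 1; ring
      _ ≤ _ := by gcongr

/-- The law of large numbers for L-statistics, along a fixed sample `x`. -/
theorem tendsto_average_mul_empiricalCdf {d F L : ℝ → ℝ} {Z : Set ℝ} (h0 : Iic 0 ⊆ Z)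
    (h1 : Ici 1 ⊆ Z) (hdc : ∀ t ∉ Z, ContinuousAt d t) {M r γ K I : ℝ} (hM : 0 ≤ M) (hr : 0 < r)
    (hγ : 0 < γ) (hγ1 : γ ≤ 1) (hK : 0 ≤ K)
    (hd : ∀ t ∈ Ioo (0 : ℝ) 1, |d t| ≤ M * (t * (1 - t)) ^ (-1 + 1 / r + γ))
    {x : ℕ → ℝ} (hx : Function.Injective x) (hF : TendstoUniformly (empiricalCdf x) F atTop)
    (hL : ∀ n, ∀ i ∈ Finset.range n, |L (x i)| ≤
      K * (empiricalCdf x n (x i) * (1 - empiricalCdf x n (x i))) ^ (-(1 / r)))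
    {J H : ℕ → ℝ}
    (hJ : ∀ m, Tendsto (fun n : ℕ => (n : ℝ)⁻¹ * ∑ i ∈ Finset.range n,
      d (F (x i)) * distCutoff Z m (F (x i)) * L (x i)) atTop (𝓝 (J m)))
    (hH : ∀ m, Tendsto (fun n : ℕ => (n : ℝ)⁻¹ * ∑ i ∈ Finset.range n,
      distCutoff Z m (F (x i))) atTop (𝓝 (H m)))
    (hJI : Tendsto J atTop (𝓝 I)) (hH1 : Tendsto H atTop (𝓝 1)) :
    Tendsto (fun n : ℕ => (n : ℝ)⁻¹ * ∑ i ∈ Finset.range n, d (empiricalCdf x n (x i)) * L (x i))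
      atTop (𝓝 I) := by
  set B : ℝ := 2 ^ (1 - γ / 2) * (2 ^ (1 - γ / 2) * (2 / (1 - (1 - γ / 2)))) with hB
  rw [Metric.tendsto_nhds]
  intro η hη
  -- Five errors of size `η / 5`: two in the tail, and one each for replacing `F_n` by `F`, the
  -- strong law, and `J m` against `I`. The order of choice is `ε`, then `m`, then `n`.
  obtain ⟨ε, hεη, hε0, hε1⟩ : ∃ ε : ℝ, M * K * (ε ^ (γ / 2) * B) < η / 5 ∧ 0 < ε ∧ ε ≤ 1 := by
    have hlim : Tendsto (fun ε : ℝ => M * K * (ε ^ (γ / 2) * B)) (𝓝[>] 0) (𝓝 0) := by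
      have : ContinuousAt (fun ε : ℝ => M * K * (ε ^ (γ / 2) * B)) 0 :=
        continuousAt_const.mul ((Real.continuousAt_rpow_const 0 _
          (Or.inr (by linarith))).mul continuousAt_const)
      have h := this.tendsto.mono_left (nhdsWithin_le_nhds (s := Ioi 0))
      simpa [Real.zero_rpow (half_pos hγ).ne'] using h
    obtain ⟨ε, h⟩ := ((hlim.eventually (gt_mem_nhds (show 0 < η / 5 by linarith))).and
      (Ioc_mem_nhdsGT (zero_lt_one' ℝ))).exists
    exact ⟨ε, h.1, h.2.1, h.2.2⟩
  have hmH : Tendsto (fun m => M * K * (ε⁻¹ * (1 - H m))) atTop (𝓝 0) := by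
    simpa using ((tendsto_const_nhds (x := (1 : ℝ))).sub hH1).const_mul ε⁻¹ |>.const_mul (M * K)
  obtain ⟨m, ⟨hm1, hm2⟩, hm0⟩ := (((hmH.eventually (gt_mem_nhds (show 0 < η / 5 by linarith))).and
    (Metric.tendsto_nhds.1 hJI (η / 5) (by linarith))).and (eventually_gt_atTop 0)).exists
  have hm0' : (0 : ℝ) < (m : ℝ)⁻¹ := by positivity
  have hψ0 : ∀ t ∉ Ioo (m : ℝ)⁻¹ (1 - (m : ℝ)⁻¹), distCutoff Z m t = 0 := fun t ht =>
    distCutoff_eq_zero_of_notMem h0 h1 hm0 ht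
  have hdψ0 : ∀ t ∉ Ioo (m : ℝ)⁻¹ (1 - (m : ℝ)⁻¹), d t * distCutoff Z m t = 0 := fun t ht => by
    rw [hψ0 t ht, mul_zero]
  have hs1 := tendsto_average_empiricalCdf_sub
    (uniformContinuous_of_eq_zero_off (continuous_mul_distCutoff hdc m) hdψ0) hm0' hdψ0 hF
    (by positivity) hK hL
  -- The case `L = 1` turns the retained fraction measured by `F_n` into the one measured by `F`.
  have hs2 := tendsto_average_empiricalCdf_sub (L := fun _ => 1) (K := 1) (s := 0)
    (uniformContinuous_of_eq_zero_off (continuous_distCutoff Z m) hψ0) hm0' hψ0 hF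
    le_rfl zero_le_one (by simp)
  have hs3 : Tendsto (fun n : ℕ => M * K * (ε⁻¹ * (1 - (n : ℝ)⁻¹ * ∑ i ∈ Finset.range n,
      distCutoff Z m (empiricalCdf x n (x i))))) atTop (𝓝 (M * K * (ε⁻¹ * (1 - H m)))) := by
    refine (((tendsto_const_nhds (x := (1 : ℝ))).sub ?_).const_mul ε⁻¹).const_mul (M * K)
    have := hs2.add (hH m)
    rw [zero_add] at this
    refine this.congr fun n => ?_
    rw [← mul_add, ← Finset.sum_add_distrib]
    simp
  filter_upwards [hs3.eventually (gt_mem_nhds hm1), Metric.tendsto_nhds.1 hs1 (η / 5) (by linarith),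
    Metric.tendsto_nhds.1 (hJ m) (η / 5) (by linarith), eventually_gt_atTop 0] with n hn1 hn2 hn3 hn0
  have hn0' : (0 : ℝ) < n := by exact_mod_cast hn0
  have htail : |(n : ℝ)⁻¹ * ∑ i ∈ Finset.range n, d (empiricalCdf x n (x i)) *
      (1 - distCutoff Z m (empiricalCdf x n (x i))) * L (x i)| ≤
      M * K * (ε⁻¹ * (1 - (n : ℝ)⁻¹ * ∑ i ∈ Finset.range n,
        distCutoff Z m (empiricalCdf x n (x i)))) + M * K * (ε ^ (γ / 2) * B) := by
    rw [abs_mul, abs_of_pos (inv_pos.2 hn0')]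
    calc (n : ℝ)⁻¹ * |∑ i ∈ Finset.range n, d (empiricalCdf x n (x i)) *
          (1 - distCutoff Z m (empiricalCdf x n (x i))) * L (x i)|
        ≤ (n : ℝ)⁻¹ * ∑ i ∈ Finset.range n, (M * K * (ε⁻¹ *
            (1 - distCutoff Z m (empiricalCdf x n (x i)))) + M * K * (ε ^ (γ / 2) *
            (empiricalCdf x n (x i) * (1 - empiricalCdf x n (x i))) ^ (-(1 - γ / 2)))) := by
          refine mul_le_mul_of_nonneg_left ((Finset.abs_sum_le_sum_abs _ _).trans
            (Finset.sum_le_sum fun i hi => ?_)) (by positivity)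
          have hy := empiricalCdf_sample_mul_pos x hi
          have hdi := hd _ ⟨empiricalCdf_sample_pos x hi, empiricalCdf_lt_one x n _⟩
          have hLi := hL n i hi
          have hψ1 := distCutoff_nonneg Z m (empiricalCdf x n (x i))
          have hψ2 := distCutoff_le_one Z m (empiricalCdf x n (x i))
          set y := empiricalCdf x n (x i) * (1 - empiricalCdf x n (x i))
          set p := distCutoff Z m (empiricalCdf x n (x i))
          have hdL : |d (empiricalCdf x n (x i))| * |L (x i)| ≤ M * K * y ^ (-1 + γ) :=
            (mul_le_mul hdi hLi (abs_nonneg _) (by positivity)).trans_eq <| by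
              rw [mul_mul_mul_comm, ← Real.rpow_add hy]
              congr 2
              ring
          have hq : 0 ≤ 1 - p := sub_nonneg.2 hψ2
          have hyε := rpow_le_inv_add hγ hγ1 hε0 hε1 hy
          have hpos : 0 ≤ ε ^ (γ / 2) * y ^ (-(1 - γ / 2)) := by positivity
          rw [abs_mul, abs_mul, abs_of_nonneg hq]
          calc |d (empiricalCdf x n (x i))| * (1 - p) * |L (x i)|
              = |d (empiricalCdf x n (x i))| * |L (x i)| * (1 - p) := by ring
            _ ≤ M * K * y ^ (-1 + γ) * (1 - p) := by gcongr
            _ ≤ M * K * (ε⁻¹ + ε ^ (γ / 2) * y ^ (-(1 - γ / 2))) * (1 - p) := by gcongr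
            _ = M * K * (ε⁻¹ * (1 - p)) +
                M * K * (ε ^ (γ / 2) * y ^ (-(1 - γ / 2)) * (1 - p)) := by ring
            _ ≤ _ := add_le_add le_rfl (mul_le_mul_of_nonneg_left
                (mul_le_of_le_one_right hpos (by linarith)) (by positivity))
      _ = M * K * (ε⁻¹ * (1 - (n : ℝ)⁻¹ * ∑ i ∈ Finset.range n,
            distCutoff Z m (empiricalCdf x n (x i)))) + M * K * (ε ^ (γ / 2) *
            ((n : ℝ)⁻¹ * ∑ i ∈ Finset.range n,
              (empiricalCdf x n (x i) * (1 - empiricalCdf x n (x i))) ^ (-(1 - γ / 2)))) := by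
          rw [Finset.sum_add_distrib, ← Finset.mul_sum, ← Finset.mul_sum, ← Finset.mul_sum,
            ← Finset.mul_sum, Finset.sum_sub_distrib]
          simp only [Finset.sum_const, Finset.card_range, nsmul_eq_mul, mul_one]
          field_simp
      _ ≤ _ := by
          gcongr
          exact average_rpow_empiricalCdf_le (by linarith) (by linarith) hx n
  have hsplit : (n : ℝ)⁻¹ * ∑ i ∈ Finset.range n, d (empiricalCdf x n (x i)) * L (x i) =
      (n : ℝ)⁻¹ * (∑ i ∈ Finset.range n, d (empiricalCdf x n (x i)) *
        (1 - distCutoff Z m (empiricalCdf x n (x i))) * L (x i)) +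
      (n : ℝ)⁻¹ * (∑ i ∈ Finset.range n, (d (empiricalCdf x n (x i)) *
        distCutoff Z m (empiricalCdf x n (x i)) - d (F (x i)) * distCutoff Z m (F (x i))) *
        L (x i)) +
      (n : ℝ)⁻¹ * ∑ i ∈ Finset.range n, d (F (x i)) * distCutoff Z m (F (x i)) * L (x i) := by
    rw [← mul_add, ← mul_add, ← Finset.sum_add_distrib, ← Finset.sum_add_distrib]
    congr 1
    exact Finset.sum_congr rfl fun i _ => by ring
  rw [hsplit]
  rw [Real.dist_eq] at hn2 hn3 hm2 ⊢
  have a1 := abs_le.1 htail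
  have a2 := abs_lt.1 hn2
  have a3 := abs_lt.1 hn3
  have a4 := abs_lt.1 hm2
  rw [abs_lt]
  constructor <;> linarith [a1.1, a1.2, a2.1, a2.2, a3.1, a3.2, a4.1, a4.2]

end

/-! ### Almost sure convergence of L-statistics -/

section Consistency

variable {Ω : Type*} [MeasurableSpace Ω] {P : Measure Ω}
  {μ : Measure ℝ} [IsProbabilityMeasure μ] {X : ℕ → Ω → ℝ}

/-- The Glivenko-Cantelli theorem for continuous laws. -/
theorem ae_tendstoUniformly_empiricalCdf [NullSingletonClass μ] (hindep : iIndepFun X P)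
    (hlaw : ∀ i, HasLaw (X i) μ P) :
    ∀ᵐ ω ∂P, TendstoUniformly (empiricalCdf fun i => X i ω) (cdf μ) atTop := by
  have h : ∀ᵐ ω ∂P, ∀ q : ℚ, Tendsto (fun n : ℕ => (n : ℝ)⁻¹ * ∑ i ∈ Finset.range n,
      (Iic (q : ℝ)).indicator (fun _ => (1 : ℝ)) (X i ω)) atTop (𝓝 (cdf μ q)) := by
    rw [ae_all_iff]
    intro q
    have := ae_tendsto_average hindep hlaw (f := (Iic (q : ℝ)).indicator fun _ => (1 : ℝ))
      (measurable_const.indicator measurableSet_Iic)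
      ((integrable_const _).indicator measurableSet_Iic)
    rwa [integral_indicator_const _ measurableSet_Iic, smul_eq_mul, mul_one,
      ← cdf_eq_real] at this
  filter_upwards [h] with ω hω
  refine tendstoUniformly_of_monotone (monotone_cdf μ) continuous_cdf (tendsto_cdf_atBot μ)
    (tendsto_cdf_atTop μ) (empiricalCdf_monotone _) (empiricalCdf_nonneg _)
    (fun n x => (empiricalCdf_lt_one _ n x).le) fun q => ?_
  -- The rescaling by `n / (n + 1)` disappears in the limit.
  have h1 := (tendsto_natCast_div_add_atTop (1 : ℝ)).mul (hω q)
  rw [one_mul] at h1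
  refine h1.congr' ?_
  filter_upwards [eventually_gt_atTop 0] with n hn
  rw [empiricalCdf]
  field_simp

/-- The strong law of large numbers for L-statistics. -/
theorem ae_tendsto_average_mul_empiricalCdf [IsProbabilityMeasure P] [NullSingletonClass μ]
    (hindep : iIndepFun X P) (hlaw : ∀ i, HasLaw (X i) μ P) {d L h₁ h₂ : ℝ → ℝ} (hdm : Measurable d) (hLm : Measurable L)
    (hfin : Integrable (fun x => d (cdf μ x) * L x) μ)
    (hmono₁ : Monotone h₁) (hmono₂ : Monotone h₂) (hdiff : ∀ x, L x = h₁ x - h₂ x)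
    {r : ℝ} (hr : 0 < r) (hmom₁ : Integrable (fun x => |h₁ x| ^ r) μ)
    (hmom₂ : Integrable (fun x => |h₂ x| ^ r) μ)
    (hbound : ∃ M > 0, ∃ γ > 0, ∀ t ∈ Ioo (0 : ℝ) 1,
      |d t| ≤ M * (t * (1 - t)) ^ (-1 + 1 / r + γ))
    (hcont : ∃ S : Finset ℝ, ∀ t ∈ Ioo (0 : ℝ) 1, t ∉ S → ContinuousAt d t) :
    ∀ᵐ ω ∂P, Tendsto (fun n : ℕ => (n : ℝ)⁻¹ * ∑ i ∈ Finset.range n,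
      d (empiricalCdf (fun i => X i ω) n (X i ω)) * L (X i ω)) atTop
      (𝓝 (∫ x, d (cdf μ x) * L x ∂μ)) := by
  obtain ⟨M, hM, γ₀, hγ₀, hd₀⟩ := hbound
  obtain ⟨S, hS⟩ := hcont
  obtain ⟨γ, hγ, hγ1, hd⟩ : ∃ γ : ℝ, 0 < γ ∧ γ ≤ 1 ∧ ∀ t ∈ Ioo (0 : ℝ) 1,
      |d t| ≤ M * (t * (1 - t)) ^ (-1 + 1 / r + γ) := by
    -- Since `t * (1 - t) ≤ 1`, lowering `γ` only weakens the bound.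
    refine ⟨min γ₀ 1, by positivity, min_le_right _ _, fun t ht => (hd₀ t ht).trans ?_⟩
    have h1 : 0 < t * (1 - t) := mul_pos ht.1 (sub_pos.2 ht.2)
    exact mul_le_mul_of_nonneg_left (Real.rpow_le_rpow_of_exponent_ge h1
      (by nlinarith [ht.1, ht.2]) (by linarith [min_le_left γ₀ 1])) hM.le
  set Z : Set ℝ := Iic 0 ∪ Ici 1 ∪ S with hZdef
  have hZ0 : Iic 0 ⊆ Z := fun t ht => Or.inl (Or.inl ht)
  have hZ1 : Ici 1 ⊆ Z := fun t ht => Or.inl (Or.inr ht)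
  have hZc : IsClosed Z := (isClosed_Iic.union isClosed_Ici).union S.finite_toSet.isClosed
  have hZne : Z.Nonempty := ⟨0, hZ0 (mem_Iic.2 le_rfl)⟩
  have hdc : ∀ t ∉ Z, ContinuousAt d t := fun t ht => by
    simp only [hZdef, mem_union, not_or, mem_Iic, mem_Ici, not_le] at ht
    exact hS t ht.1 ht.2
  have hFZ : ∀ᵐ x ∂μ, cdf μ x ∉ Z := by
    have hS' : ∀ᵐ x ∂μ, ∀ s ∈ S, cdf μ x ≠ s :=
      (Finset.eventually_all S).2 fun s _ => ae_cdf_ne s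
    filter_upwards [ae_cdf_ne (μ := μ) 0, ae_cdf_ne (μ := μ) 1, hS'] with x h0 h1 hs
    simp only [hZdef, mem_union, not_or, mem_Iic, mem_Ici, not_le]
    exact ⟨⟨lt_of_le_of_ne (cdf_nonneg μ x) h0.symm, lt_of_le_of_ne (cdf_le_one μ x) h1⟩,
      fun hx => hs _ hx rfl⟩
  have hFm : Measurable (cdf μ) := (monotone_cdf μ).measurable
  have hψm : ∀ m, Measurable fun x => distCutoff Z m (cdf μ x) := fun m =>
    (continuous_distCutoff Z m).measurable.comp hFm
  have hdψm : ∀ m, Measurable fun x => d (cdf μ x) * distCutoff Z m (cdf μ x) * L x := fun m =>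
    ((hdm.comp hFm).mul (hψm m)).mul hLm
  have hdψle : ∀ m x, ‖d (cdf μ x) * distCutoff Z m (cdf μ x) * L x‖ ≤
      ‖d (cdf μ x) * L x‖ := fun m x => by
    rw [mul_right_comm, norm_mul (d (cdf μ x) * L x)]
    refine mul_le_of_le_one_right (norm_nonneg _) ?_
    rw [Real.norm_of_nonneg (distCutoff_nonneg _ _ _)]
    exact distCutoff_le_one _ _ _
  have hψle : ∀ m x, ‖distCutoff Z m (cdf μ x)‖ ≤ 1 := fun m x => by
    rw [Real.norm_of_nonneg (distCutoff_nonneg _ _ _)]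
    exact distCutoff_le_one _ _ _
  have hJ : ∀ᵐ ω ∂P, ∀ m, Tendsto (fun n : ℕ => (n : ℝ)⁻¹ * ∑ i ∈ Finset.range n,
      d (cdf μ (X i ω)) * distCutoff Z m (cdf μ (X i ω)) * L (X i ω)) atTop
      (𝓝 (∫ x, d (cdf μ x) * distCutoff Z m (cdf μ x) * L x ∂μ)) := by
    rw [ae_all_iff]
    intro m
    exact ae_tendsto_average hindep hlaw (hdψm m)
      (hfin.mono (hdψm m).aestronglyMeasurable (ae_of_all _ (hdψle m)))
  have hH : ∀ᵐ ω ∂P, ∀ m, Tendsto (fun n : ℕ => (n : ℝ)⁻¹ * ∑ i ∈ Finset.range n,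
      distCutoff Z m (cdf μ (X i ω))) atTop (𝓝 (∫ x, distCutoff Z m (cdf μ x) ∂μ)) := by
    rw [ae_all_iff]
    intro m
    exact ae_tendsto_average hindep hlaw (hψm m)
      (Integrable.of_bound (hψm m).aestronglyMeasurable 1 (ae_of_all _ (hψle m)))
  have hJI : Tendsto (fun m => ∫ x, d (cdf μ x) * distCutoff Z m (cdf μ x) * L x ∂μ) atTop
      (𝓝 (∫ x, d (cdf μ x) * L x ∂μ)) := by
    refine tendsto_integral_of_dominated_convergence (fun x => ‖d (cdf μ x) * L x‖)
      (fun m => (hdψm m).aestronglyMeasurable) hfin.norm (fun m => ae_of_all _ (hdψle m)) ?_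
    filter_upwards [hFZ] with x hx
    simpa using ((tendsto_distCutoff hZc hZne hx).const_mul (d (cdf μ x))).mul_const (L x)
  have hH1 : Tendsto (fun m => ∫ x, distCutoff Z m (cdf μ x) ∂μ) atTop (𝓝 1) := by
    have : Tendsto (fun m => ∫ x, distCutoff Z m (cdf μ x) ∂μ) atTop (𝓝 (∫ _, (1 : ℝ) ∂μ)) := by
      refine tendsto_integral_of_dominated_convergence (fun _ => 1)
        (fun m => (hψm m).aestronglyMeasurable) (integrable_const _)
        (fun m => ae_of_all _ (hψle m)) ?_
      filter_upwards [hFZ] with x hx using tendsto_distCutoff hZc hZne hx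
    simpa using this
  filter_upwards [ae_injective_sample hindep hlaw, ae_tendstoUniformly_empiricalCdf hindep hlaw,
    hJ, hH, ae_tendsto_average hindep hlaw (hmono₁.measurable.abs.pow_const r) hmom₁,
    ae_tendsto_average hindep hlaw (hmono₂.measurable.abs.pow_const r) hmom₂]
    with ω hinj hunif hJω hHω ha₁ ha₂
  -- A convergent sequence of empirical moments is bounded, which gives one constant for all `n`;
  -- the empty average at `n = 0` shows that it is nonnegative.
  obtain ⟨A₁, hA₁⟩ := ha₁.bddAbove_range
  obtain ⟨A₂, hA₂⟩ := ha₂.bddAbove_range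
  have hA₁' := fun n => hA₁ (mem_range_self n)
  have hA₂' := fun n => hA₂ (mem_range_self n)
  have hA₁0 : 0 ≤ A₁ := by simpa using hA₁' 0
  have hA₂0 : 0 ≤ A₂ := by simpa using hA₂' 0
  refine tendsto_average_mul_empiricalCdf hZ0 hZ1 hdc hM.le hr hγ hγ1
    (K := A₁ ^ (1 / r) + A₂ ^ (1 / r)) (by positivity) hd hinj hunif (fun n i hi => ?_)
    hJω hHω hJI hH1
  rw [hdiff, add_mul]
  exact (abs_sub _ _).trans (add_le_add
    (abs_le_of_average_le hmono₁ hr (fun i => X i ω) hi (hA₁' n))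
    (abs_le_of_average_le hmono₂ hr (fun i => X i ω) hi (hA₂' n)))

theorem lambdaStar_monotone {d : ℝ → ℝ} {ℓ : ℝ → ℝ → ℝ} (hd : ∀ t, 0 ≤ d t)
    (hconv : ∀ x, ConvexOn ℝ univ (fun c => ℓ x c)) (x : ℕ → ℝ) (n : ℕ) :
    Monotone (lambdaStar d ℓ x n) := fun _ _ hab =>
  mul_le_mul_of_nonneg_left (Finset.sum_le_sum fun _ _ =>
    mul_le_mul_of_nonneg_left (lossDeriv_monotone hconv _ hab) (hd _)) (by positivity)

end Consistency

/-! ### From pointwise convergence to M-estimates -/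

/-- If a monotone `g` is smaller in absolute value at `e` than at points on both sides where it
has opposite signs, then its M-estimates lie between these points. -/
theorem IsMEstimate.mem_Icc {g : ℝ → ℝ} (hg : Monotone g) {a e b c : ℝ} (ha : g a < -|g e|)
    (hb : |g e| < g b) (hc : IsMEstimate g c) : c ∈ Icc a b := by
  have key : ∀ u, |g u| ≤ |g e| → u ∈ Icc a b := by
    intro u hu
    rw [abs_le] at hu
    constructor <;> by_contra! hlt
    · linarith [hg hlt.le]
    · linarith [hg hlt.le]
  rcases hc with hc | ⟨_, hc⟩ | ⟨_, hc⟩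
  · exact key c (by rw [hc, abs_zero]; exact abs_nonneg _)
  · exact key c (hc e)
  -- Points `u` arbitrarily near `c` satisfy `|g u| ≤ |g e|`, so `c` is a limit of points of the
  -- closed interval.
  · refine isClosed_Icc.closure_subset (Metric.mem_closure_iff.2 fun ε hε => ?_)
    obtain ⟨u, hu, hgu⟩ := hc ε hε e
    exact ⟨u, key u hgu, by rwa [dist_comm, Real.dist_eq]⟩

/-- M-estimates of monotone functions converge if the functions converge to a function with a
unique root. -/
theorem tendsto_of_isMEstimate {g : ℕ → ℝ → ℝ} {f : ℝ → ℝ} {e : ℝ} (hg : ∀ n, Monotone (g n))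
    (hf : Monotone f) (he : f e = 0) (huniq : ∀ t, f t = 0 → t = e)
    (hlim : ∀ q : ℚ, Tendsto (fun n => g n (e + q)) atTop (𝓝 (f (e + q)))) {T : ℕ → ℝ}
    (hT : ∀ᶠ n in atTop, IsMEstimate (g n) (T n)) : Tendsto T atTop (𝓝 e) := by
  rw [Metric.tendsto_nhds]
  intro ε hε
  obtain ⟨q, hq0, hqε⟩ := exists_rat_btwn hε
  have hpos : 0 < f (e + q) :=
    lt_of_le_of_ne (he ▸ hf (by linarith)) fun h => by linarith [huniq _ h.symm]
  have hneg : f (e + (-q : ℚ)) < 0 := by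
    push_cast
    exact lt_of_le_of_ne (he ▸ hf (by linarith)) fun h => by linarith [huniq _ h]
  have h0 : Tendsto (fun n => |g n e|) atTop (𝓝 0) := by
    simpa [he] using (hlim 0).abs
  have hlt := h0.eventually_lt (hlim q) hpos
  have hgt := (hlim (-q)).eventually_lt h0.neg (by simpa using hneg)
  filter_upwards [hT, hlt, hgt] with n hn h1 h2
  have := hn.mem_Icc (hg n) h2 h1
  push_cast at this
  rw [Real.dist_eq, abs_lt]
  constructor <;> linarith [this.1, this.2]

theorem mainTheorem3
    {Ω : Type*} [MeasurableSpace Ω] (P : Measure Ω) [IsProbabilityMeasure P]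
    -- the law of `X`, and an i.i.d. sample from it
    (μ : Measure ℝ) [IsProbabilityMeasure μ]
    (X : ℕ → Ω → ℝ) (hindep : iIndepFun X P) (hlaw : ∀ i, HasLaw (X i) μ P)
    -- the distortion `D` with density `d`, and the loss
    (D d : ℝ → ℝ) (hD : IsDistortion D d) (ℓ : ℝ → ℝ → ℝ)
    -- `X` has a density; `λ_F` is finite with a unique root; convexity and measurability
    (hac : μ ≪ volume)
    (hfin : ∀ c, Integrable (fun x => d (cdf μ x) * lossDeriv ℓ x c) μ)
    (hroot : ∃! t₀ : ℝ, lambdaF μ d ℓ t₀ = 0)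
    (hconv : ∀ x, ConvexOn ℝ univ (fun c => ℓ x c))
    (hmeas : ∀ c, Measurable (fun x => lossDeriv ℓ x c))
    -- `ℓ` has derivative `h₁ - h₂` with `h₁`, `h₂` non-decreasing, left continuous in `x`
    (h₁ h₂ : ℝ → ℝ → ℝ)
    (hmono₁ : ∀ c, Monotone (fun x => h₁ x c)) (hmono₂ : ∀ c, Monotone (fun x => h₂ x c))
    (hleft₁ : ∀ c x, ContinuousWithinAt (fun y => h₁ y c) (Iic x) x)
    (hleft₂ : ∀ c x, ContinuousWithinAt (fun y => h₂ y c) (Iic x) x)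
    (hdiff : ∀ x c, lossDeriv ℓ x c = h₁ x c - h₂ x c)
    -- moments of order `r`
    (r : ℝ) (hr : 0 < r)
    (hmom₁ : ∀ c, Integrable (fun x => |h₁ x c| ^ r) μ)
    (hmom₂ : ∀ c, Integrable (fun x => |h₂ x c| ^ r) μ)
    -- growth of the density
    (hbound : ∃ M > 0, ∃ γ > 0, ∀ t ∈ Ioo (0 : ℝ) 1,
      |d t| ≤ M * (t * (1 - t)) ^ (-1 + 1 / r + γ))
    -- the density is continuous up to finitely many points
    (hcont : ∃ S : Finset ℝ, ∀ t ∈ Ioo (0 : ℝ) 1, t ∉ S → ContinuousAt d t)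
    -- the M-estimator
    (T : ℕ → Ω → ℝ)
    (hT : ∀ᵐ ω ∂P, ∀ᶠ n in atTop,
      IsMEstimate (lambdaStar d ℓ (fun i => X i ω) n) (T n ω)) :
    ∃ e : ℝ, (∀ c, IsGeneralizedExtremile μ d ℓ c ↔ c = e) ∧
      ∀ᵐ ω ∂P, Tendsto (fun n => T n ω) atTop (𝓝 e) := by
  obtain ⟨e, he, huniq⟩ := hroot
  refine ⟨e, isGeneralizedExtremile_iff hD.measurable_density hD.nonneg_density hfin hconv hmeas
    he huniq, ?_⟩
  have : NullSingletonClass μ := ⟨fun x => hac (measure_singleton x)⟩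
  -- Rational offsets from `e` leave a single null set to discard.
  have hlim : ∀ᵐ ω ∂P, ∀ q : ℚ, Tendsto (fun n => lambdaStar d ℓ (fun i => X i ω) n (e + q)) atTop
      (𝓝 (lambdaF μ d ℓ (e + q))) := by
    rw [ae_all_iff]
    intro q
    exact ae_tendsto_average_mul_empiricalCdf hindep hlaw hD.measurable_density (hmeas _) (hfin _)
      (hmono₁ _) (hmono₂ _) (fun x => hdiff x _) hr (hmom₁ _) (hmom₂ _) hbound hcont
  filter_upwards [hT, hlim] with ω hTω hω
  exact tendsto_of_isMEstimate (lambdaStar_monotone hD.nonneg_density hconv _)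
    (lambdaF_monotone hD.nonneg_density hfin hconv) he huniq hω hTω
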